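/- For $\alpha>-1$ and $k\in\mathbb N_0$ let $L_k^\alpha(x)=\sum_{j=0}^k(-1)^j\frac{\Gamma(k+\alpha+1)}{\Gamma(j+\alpha+1)\,(k-j)!}\frac{x^j}{j!}$ be the Laguerre polynomials and $l_k^\alpha(x)=\big(k!/\Gamma(k+\alpha+1)\big)^{1/2}e^{-x/2}L_k^\alpha(x)$ the Laguerre functions. For a measurable $f:(0,\infty)\to\mathbb R$ with $\int_0^\infty|f(x)|^p x^\gamma\,dx<\infty$ for some $1\le p<\infty$ and some $\gamma>-1$ such that $\gamma<p(\alpha+1)-1$ (or $p=1$, $\gamma=\alpha$), write $f\sim\sum_{k}c_kL_k^\alpha(x)e^{-x/2}$ if $$\int_0^\infty f(x)\,l_k^\alpha(x)\,x^\alpha\,dx=c_k\Big(\frac{\Gamma(k+\alpha+1)}{k!}\Big)^{1/2}\qquad\text{for all }k\in\mathbb N_0 .$$ **Lemma 2.1.** Let $\alpha>-1$ and $0<\sigma<\alpha+1$. There is a function $g_\sigma$ of this kind, unique up to null sets, with $$g_\sigma(x)\sim\Gamma(\alpha+1)\sum_{k=0}^\infty (k+1)^{-\sigma}L_k^\alpha(x)e^{-x/2},$$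 it has a representative that is continuous on $(0,\infty)$, and there is a constant $C>0$, depending only on $\alpha$ and $\sigma$, such that this representative satisfies $$|g_\sigma(x)|\le C\,x^{\sigma-\alpha-1}\qquad\text{for all }x>0 .$$ -/

import Mathlib

open MeasureTheory Set
open scoped Nat

namespace LaguerreKernel

/-- The generalized Laguerre polynomial
`L_k^α(x) = ∑_{j=0}^k (-1)^j binom(k+α, k-j) x^j / j!`, where
`binom(k+α, k-j) = Γ(k+α+1) / (Γ(j+α+1) (k-j)!)`; for `α > -1` all the Gamma arguments are
positive. -/
noncomputable def laguerre (α : ℝ) (k : ℕ) (x : ℝ) : ℝ :=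
  ∑ j ∈ Finset.range (k + 1),
    (-1) ^ j * (Real.Gamma (k + α + 1) / (Real.Gamma (j + α + 1) * ((k - j)! : ℝ)))
      * (x ^ j / (j ! : ℝ))

/-- The orthonormal Laguerre function
`l_k^α(x) = (k! / Γ(k+α+1))^{1/2} e^{-x/2} L_k^α(x)` on `L²((0,∞), x^α dx)`. -/
noncomputable def laguerreFun (α : ℝ) (k : ℕ) (x : ℝ) : ℝ :=
  Real.sqrt ((k ! : ℝ) / Real.Gamma (k + α + 1)) * Real.exp (-x / 2) * laguerre α k x

/-- Membership in the weighted space `L^p_{v(γ)}` of functions on `(0,∞)` with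
`∫_0^∞ |f(x)|^p x^γ dx < ∞`. -/
def MemWeightedLp (p γ : ℝ) (f : ℝ → ℝ) : Prop :=
  AEStronglyMeasurable f (volume.restrict (Ioi 0)) ∧
    IntegrableOn (fun x => |f x| ^ p * x ^ γ) (Ioi 0)

/-- `f` lies in one of the weighted spaces `L^p_{v(γ)}` on whose elements the Laguerre
coefficients of order `α` are defined: `1 ≤ p < ∞`, `γ > -1` and `γ < p(α+1) - 1`
(for `p = 1` also the endpoint `γ = α`). -/
def LaguerreAdmissible (α : ℝ) (f : ℝ → ℝ) : Prop :=
  ∃ p γ : ℝ, 1 ≤ p ∧ -1 < γ ∧ (γ < p * (α + 1) - 1 ∨ (p = 1 ∧ γ = α)) ∧ MemWeightedLp p γ f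

/-- The Laguerre coefficient `a_k = ∫_0^∞ f(x) l_k^α(x) x^α dx`. -/
noncomputable def laguerreCoeff (α : ℝ) (f : ℝ → ℝ) (k : ℕ) : ℝ :=
  ∫ x in Ioi 0, f x * laguerreFun α k x * x ^ α

/-- `f ∼ ∑ a_k l_k^α`: the function `f` has the Laguerre series with coefficients `a`. -/
def HasLaguerreSeries (α : ℝ) (f : ℝ → ℝ) (a : ℕ → ℝ) : Prop :=
  LaguerreAdmissible α f ∧ ∀ k, laguerreCoeff α f k = a k

/-- Conversion between the two normalizations:
`L_k^α(x) e^{-x/2} = (Γ(k+α+1) / k!)^{1/2} l_k^α(x)`. -/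
theorem laguerre_mul_exp {α : ℝ} (hα : -1 < α) (k : ℕ) (x : ℝ) :
    laguerre α k x * Real.exp (-x / 2) =
      Real.sqrt (Real.Gamma (k + α + 1) / (k ! : ℝ)) * laguerreFun α k x := by
  have hk : (0 : ℝ) ≤ k := Nat.cast_nonneg k
  have hG : 0 < Real.Gamma (k + α + 1) := Real.Gamma_pos_of_pos (by linarith)
  have hf : (0 : ℝ) < (k ! : ℝ) := by exact_mod_cast Nat.factorial_pos k
  have h : Real.sqrt (Real.Gamma (k + α + 1) / (k ! : ℝ)) *
      Real.sqrt ((k ! : ℝ) / Real.Gamma (k + α + 1)) = 1 := by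
    rw [← Real.sqrt_mul (by positivity)]
    have : Real.Gamma (k + α + 1) / (k ! : ℝ) * ((k ! : ℝ) / Real.Gamma (k + α + 1)) = 1 := by
      field_simp
    rw [this, Real.sqrt_one]
  unfold laguerreFun
  rw [mul_assoc, ← mul_assoc, h, one_mul, mul_comm]

/-- `f ∼ ∑ c_k L_k^α(x) e^{-x/2}`, that is, `f ∼ ∑ c_k (Γ(k+α+1) / k!)^{1/2} l_k^α`. -/
def HasLaguerrePolySeries (α : ℝ) (f : ℝ → ℝ) (c : ℕ → ℝ) : Prop :=
  HasLaguerreSeries α f (fun k => c k * Real.sqrt (Real.Gamma (k + α + 1) / (k ! : ℝ)))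

/-- `g` is (a version of) the fractional integration kernel `g_σ`:
`g(x) ∼ Γ(α+1) ∑ (k+1)^{-σ} L_k^α(x) e^{-x/2}`. -/
def IsFractionalKernel (α σ : ℝ) (g : ℝ → ℝ) : Prop :=
  HasLaguerrePolySeries α g (fun k => Real.Gamma (α + 1) * ((k : ℝ) + 1) ^ (-σ))

end LaguerreKernel

namespace LaguerreKernel

open ProbabilityTheory Filter Topology

/-! Existence rests on an explicit formula. Writing `(k+1)^(-σ)` as `Γ(σ)⁻¹ ∫ t^(σ-1) e^(-(k+1)t)
dt` and summing formally with the Laguerre generating function at `r = e^(-t)` suggests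
`fractionalKernel`. No series is summed: its coefficients are computed by Fubini from the Laplace
transform of `x^α L_k^α`. Near `t = 0` the integrand behaves like `t^(σ-α-2) e^(-x/t)`, and it is
dominated for all `t > 0` by a multiple of `t^(σ-α-2) e^(-x/(2t))`. The integral of this bound
scales as `x^(σ-α-1)`, and domination also gives continuity.

Uniqueness is a moment problem. Since `L_k^α` has exact degree `k`, the coefficients of `f`
determine all moments of `f(x) x^α e^(-x/2)`. The exponential weight makes that problem determinate:
the transforms are analytic in a strip, so the identity theorem applies. -/

/-! ### Determinacy of the moment problem under exponential decay. -/

theorem Ioo_subset_integrableExpSet {μ : Measure ℝ} {c : ℝ}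
    (hμ : Integrable (fun x => Real.exp (c * |x|)) μ) :
    Ioo (-c) c ⊆ integrableExpSet id μ := by
  intro t ht
  refine Integrable.mono' hμ (by fun_prop) (ae_of_all _ fun x => ?_)
  rw [Real.norm_eq_abs, Real.abs_exp, Real.exp_le_exp]
  calc t * id x ≤ |t * x| := le_abs_self _
    _ = |t| * |x| := abs_mul _ _
    _ ≤ c * |x| := by gcongr; exact (abs_lt.2 ht).le

/-- Two finite measures with an exponential moment and the same moments are equal. -/
theorem measure_ext_of_moments {μ ν : Measure ℝ} [IsFiniteMeasure μ] [IsFiniteMeasure ν] {c : ℝ}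
    (hc : 0 < c) (hμ : Integrable (fun x => Real.exp (c * |x|)) μ)
    (hν : Integrable (fun x => Real.exp (c * |x|)) ν)
    (h : ∀ n : ℕ, ∫ x, x ^ n ∂μ = ∫ x, x ^ n ∂ν) : μ = ν := by
  have key : ∀ ρ : Measure ℝ, Integrable (fun x => Real.exp (c * |x|)) ρ →
      ∀ z : ℂ, z.re ∈ Ioo (-c) c → z.re ∈ interior (integrableExpSet id ρ) :=
    fun ρ hρ z hz => interior_mono (Ioo_subset_integrableExpSet hρ) (by rwa [interior_Ioo])
  have h0 : (0 : ℂ).re ∈ Ioo (-c) c := by simp [hc]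
  have hder : ∀ n, iteratedDeriv n (complexMGF id μ - complexMGF id ν) 0 = 0 := by
    intro n
    have hm := (analyticAt_complexMGF (key μ hμ 0 h0)).contDiffAt (n := n)
    have hn := (analyticAt_complexMGF (key ν hν 0 h0)).contDiffAt (n := n)
    rw [iteratedDeriv_sub hm hn, iteratedDeriv_complexMGF (key μ hμ 0 h0),
      iteratedDeriv_complexMGF (key ν hν 0 h0)]
    have := congrArg (fun r : ℝ => (r : ℂ)) (h n)
    simp only [← integral_complex_ofReal] at this
    simpa [sub_eq_zero] using this
  have hsub : AnalyticAt ℂ (complexMGF id μ - complexMGF id ν) 0 :=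
    (analyticAt_complexMGF (key μ hμ 0 h0)).sub (analyticAt_complexMGF (key ν hν 0 h0))
  -- The derivatives at `0` are the moments, so the difference vanishes there to infinite order.
  have hloc : complexMGF id μ =ᶠ[𝓝 0] complexMGF id ν := by
    have htop : analyticOrderAt (complexMGF id μ - complexMGF id ν) 0 = ⊤ :=
      ENat.eq_top_iff_forall_ge.2 fun n =>
        (natCast_le_analyticOrderAt_iff_iteratedDeriv_eq_zero hsub).2 fun i _ => hder i
    filter_upwards [analyticOrderAt_eq_top.1 htop] with z hz
    simpa [sub_eq_zero] using hz
  have hconv : Convex ℝ {z : ℂ | z.re ∈ Ioo (-c) c} :=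
    (convex_Ioo (-c) c).linear_preimage Complex.reLm
  have hEq : EqOn (complexMGF id μ) (complexMGF id ν) {z : ℂ | z.re ∈ Ioo (-c) c} :=
    AnalyticOnNhd.eqOn_of_preconnected_of_eventuallyEq
      (fun z hz => analyticAt_complexMGF (key μ hμ z hz))
      (fun z hz => analyticAt_complexMGF (key ν hν z hz)) hconv.isPreconnected h0 hloc
  refine Measure.ext_of_charFun (funext fun t => ?_)
  rw [← complexMGF_id_mul_I, ← complexMGF_id_mul_I]
  exact hEq (by simp [hc])

/-- An integrable function on the half-line is determined by its moments against `exp (-a x)`. -/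
theorem ae_eq_zero_of_moments {D : ℝ → ℝ} {a : ℝ} (ha : 0 < a) (hD : IntegrableOn D (Ioi 0))
    (h : ∀ n : ℕ, ∫ x in Ioi 0, D x * Real.exp (-(a * x)) * x ^ n = 0) :
    D =ᵐ[volume.restrict (Ioi 0)] 0 := by
  set m : Measure ℝ := volume.restrict (Ioi 0) with hm
  have hpos : ∀ᵐ x ∂m, (0 : ℝ) < x := ae_restrict_mem measurableSet_Ioi
  have hbound : ∀ n : ℕ, ∃ M : ℝ, ∀ x : ℝ, 0 < x → ‖Real.exp (-(a * x)) * x ^ n‖ ≤ M := by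
    intro n
    refine ⟨n ! / a ^ n, fun x hx => ?_⟩
    rw [Real.norm_of_nonneg (by positivity), Real.exp_neg, inv_mul_le_iff₀ (Real.exp_pos _)]
    have := Real.pow_div_factorial_le_exp (a * x) (by positivity) n
    rw [mul_pow, div_le_iff₀ (by positivity)] at this
    rw [← mul_div_assoc, le_div_iff₀ (by positivity)]
    linarith
  have hint : ∀ n : ℕ, Integrable (fun x => D x * Real.exp (-(a * x)) * x ^ n) m := by
    intro n
    obtain ⟨M, hM⟩ := hbound n
    simp only [mul_assoc]
    exact Integrable.mul_bdd hD (by fun_prop) (hpos.mono fun x hx => hM x hx)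
  set u : ℝ → ℝ := fun x => D x * Real.exp (-(a * x)) with hu
  have hui : Integrable u m := by simpa using hint 0
  -- Used for `v = u` and `v = -u`: the positive and negative parts of `u` become measures, and
  -- integrability of `D` supplies their exponential moment of rate `a`.
  have hpart : ∀ v : ℝ → ℝ, Integrable v m → (∀ x, 0 < x → |v x| ≤ |u x|) →
      IsFiniteMeasure (m.withDensity fun x => ENNReal.ofReal (v x)) ∧
      Integrable (fun x => Real.exp (a * |x|)) (m.withDensity fun x => ENNReal.ofReal (v x)) ∧
      ∀ n : ℕ, ∫ x, x ^ n ∂(m.withDensity fun x => ENNReal.ofReal (v x)) =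
        ∫ x, max (v x) 0 * x ^ n ∂m := by
    intro v hv hvu
    refine ⟨isFiniteMeasure_withDensity_ofReal hv.2, ?_, fun n => ?_⟩
    · rw [integrable_withDensity_iff_integrable_smul₀' hv.1.aemeasurable.ennreal_ofReal
        (by simp)]
      refine Integrable.mono' hD.abs ?_ ?_
      · exact (hv.1.aemeasurable.ennreal_ofReal.ennreal_toReal.aestronglyMeasurable).smul
          (by fun_prop)
      · filter_upwards [hpos] with x hx
        rw [ENNReal.toReal_ofReal', smul_eq_mul, Real.norm_eq_abs, abs_mul, Real.abs_exp,
          abs_of_pos hx]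
        have h1 : |max (v x) 0| ≤ |D x| * Real.exp (-(a * x)) := by
          refine le_trans ?_ ((hvu x hx).trans (by simp [hu, abs_mul]))
          rw [abs_of_nonneg (le_max_right _ _)]
          exact max_le (le_abs_self _) (abs_nonneg _)
        calc _ ≤ |D x| * Real.exp (-(a * x)) * Real.exp (a * x) := by gcongr
          _ = |D x| := by rw [mul_assoc, ← Real.exp_add]; simp
    · rw [integral_withDensity_eq_integral_toReal_smul₀ hv.1.aemeasurable.ennreal_ofReal
        (by simp)]
      simp [ENNReal.toReal_ofReal']
  obtain ⟨f1, i1, m1⟩ := hpart u hui (fun x _ => le_rfl)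
  obtain ⟨f2, i2, m2⟩ := hpart (fun x => -u x) hui.neg (fun x _ => by simp)
  have hmeas := measure_ext_of_moments ha i1 i2 fun n => by
    rw [m1, m2, ← sub_eq_zero, ← integral_sub]
    · refine Eq.trans ?_ (h n)
      refine integral_congr_ae (ae_of_all _ fun x => ?_)
      simp only [← sub_mul]
      congr 1
      change max (u x) 0 - max (-u x) 0 = u x
      rcases le_total (u x) 0 with h0 | h0 <;> simp [h0]
    · refine Integrable.mono (hint n) (by fun_prop) (ae_of_all _ fun x => ?_)
      rw [norm_mul, norm_mul]
      gcongr
      rw [Real.norm_eq_abs, Real.norm_eq_abs, abs_of_nonneg (le_max_right _ _)]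
      exact max_le (le_abs_self _) (abs_nonneg _)
    · refine Integrable.mono (hint n) (by fun_prop) (ae_of_all _ fun x => ?_)
      rw [norm_mul, norm_mul]
      gcongr
      rw [Real.norm_eq_abs, Real.norm_eq_abs, abs_of_nonneg (le_max_right _ _)]
      exact max_le (neg_le_abs _) (abs_nonneg _)
  filter_upwards [(withDensity_eq_iff hui.1.aemeasurable.ennreal_ofReal
    hui.neg.1.aemeasurable.ennreal_ofReal hui.lintegral_lt_top.ne).1 hmeas] with x hx
  have hx' := congrArg ENNReal.toReal hx
  rw [ENNReal.toReal_ofReal', ENNReal.toReal_ofReal', Pi.neg_apply] at hx'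
  have hux : u x = 0 := by
    rcases le_total (u x) 0 with h0 | h0
    · rw [max_eq_right h0, max_eq_left (by linarith)] at hx'; linarith
    · rw [max_eq_left h0, max_eq_right (by linarith)] at hx'; linarith
  exact (mul_eq_zero.1 hux).resolve_right (Real.exp_pos _).ne'

/-! ### Admissible functions and uniqueness. -/

/-- For `s > 0`, raise `y ≤ e^y` with `y = εx/s` to the power `s`. -/
theorem rpow_le_mul_exp {s ε x : ℝ} (hs : 0 ≤ s) (hε : 0 < ε) (hx : 0 ≤ x) :
    x ^ s ≤ (s / ε) ^ s * Real.exp (ε * x) := by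
  rcases hs.eq_or_lt with rfl | hs
  · simpa using mul_nonneg hε.le hx
  · have h1 : x ≤ s / ε * Real.exp (ε * x / s) := by
      have h2 := Real.add_one_le_exp (ε * x / s)
      calc x = s / ε * (ε * x / s) := by field_simp
        _ ≤ s / ε * Real.exp (ε * x / s) := by gcongr; linarith
    calc x ^ s ≤ (s / ε * Real.exp (ε * x / s)) ^ s := by gcongr
      _ = (s / ε) ^ s * Real.exp (ε * x) := by
        rw [Real.mul_rpow (by positivity) (by positivity), ← Real.exp_mul]
        congr 2
        field_simp

/-- For `p = 1` the exponential absorbs `x^(α-γ)`. For `p > 1`, Young's inequality pairs `|f|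
x^(γ/p)` in `L^p` with `x^(α-γ/p) e^(-εx)` in `L^q`. -/
theorem LaguerreAdmissible.integrableOn_mul_rpow_mul_exp {α : ℝ} {f : ℝ → ℝ}
    (hf : LaguerreAdmissible α f) {ε : ℝ} (hε : 0 < ε) :
    IntegrableOn (fun x => f x * x ^ α * Real.exp (-(ε * x))) (Ioi 0) := by
  obtain ⟨p, γ, hp, hγ, hcond, hfm, hfi⟩ := hf
  have hpos : ∀ᵐ x ∂(volume.restrict (Ioi (0 : ℝ))), 0 < x := ae_restrict_mem measurableSet_Ioi
  have hmeas : AEStronglyMeasurable (fun x => f x * x ^ α * Real.exp (-(ε * x)))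
      (volume.restrict (Ioi 0)) := by
    refine (hfm.mul ?_).mul ?_
    · exact (measurable_id.pow_const α).aestronglyMeasurable
    · fun_prop
  rcases hp.eq_or_lt with rfl | hp1
  · have hγα : 0 ≤ α - γ := by
      rcases hcond with h | h <;> linarith
    refine Integrable.mono' (hfi.const_mul (((α - γ) / ε) ^ (α - γ))) hmeas ?_
    filter_upwards [hpos] with x hx
    have h1 := rpow_le_mul_exp hγα hε hx.le
    rw [norm_mul, norm_mul, Real.norm_eq_abs, Real.rpow_one,
      Real.norm_of_nonneg (Real.rpow_nonneg hx.le _), Real.norm_of_nonneg (Real.exp_pos _).le,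
      Real.exp_neg]
    calc |f x| * x ^ α * (Real.exp (ε * x))⁻¹
        = |f x| * x ^ γ * (x ^ (α - γ) * (Real.exp (ε * x))⁻¹) := by
          rw [show x ^ α = x ^ γ * x ^ (α - γ) by rw [← Real.rpow_add hx]; congr 1; ring]
          ring
      _ ≤ |f x| * x ^ γ * (((α - γ) / ε) ^ (α - γ) * Real.exp (ε * x) *
            (Real.exp (ε * x))⁻¹) := by gcongr
      _ = _ := by
          have := (Real.exp_pos (ε * x)).ne'
          field_simp
  · have hγα : γ < p * (α + 1) - 1 := by
      rcases hcond with h | ⟨h, -⟩ <;> linarith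
    set q := p.conjExponent with hq
    have hpq : p.HolderConjugate q := Real.HolderConjugate.conjExponent hp1
    have hq0 : 0 < q := hpq.symm.pos
    -- Integrability at `0` of the `q`-th power; this is equivalent to `γ < p(α+1) - 1`.
    have hexp : -1 < (α - γ / p) * q := by
      have hp0 : 0 < p := by linarith
      have : q = p / (p - 1) := rfl
      rw [this, ← mul_div_assoc, lt_div_iff₀ (by linarith), sub_mul, div_mul_cancel₀ _ hp0.ne']
      linarith
    have hb := integrableOn_rpow_mul_exp_neg_mul_rpow hexp one_pos (mul_pos hε hq0)
    refine Integrable.mono' ((hfi.div_const p).add (hb.div_const q)) hmeas ?_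
    filter_upwards [hpos] with x hx
    have hy := Real.young_inequality_of_nonneg (a := |f x| * x ^ (γ / p))
      (b := x ^ (α - γ / p) * Real.exp (-(ε * x))) (by positivity) (by positivity) hpq
    rw [norm_mul, norm_mul, Real.norm_eq_abs,
      Real.norm_of_nonneg (Real.rpow_nonneg hx.le _), Real.norm_of_nonneg (Real.exp_pos _).le]
    refine le_trans (le_of_eq ?_) (hy.trans (le_of_eq ?_))
    · rw [show x ^ α = x ^ (γ / p) * x ^ (α - γ / p) by rw [← Real.rpow_add hx]; congr 1; ring]
      ring
    · rw [Real.mul_rpow (abs_nonneg _) (by positivity), ← Real.rpow_mul hx.le,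
        div_mul_cancel₀ _ hpq.ne_zero, Real.mul_rpow (by positivity) (by positivity),
        ← Real.rpow_mul hx.le, ← Real.exp_mul]
      simp only [Pi.add_apply, Real.rpow_one]
      congr 4
      ring

theorem LaguerreAdmissible.integrableOn_mul_rpow_mul_exp_mul_pow {α : ℝ} {f : ℝ → ℝ}
    (hf : LaguerreAdmissible α f) (n : ℕ) :
    IntegrableOn (fun x => f x * x ^ α * Real.exp (-(1 / 2 * x)) * x ^ n) (Ioi 0) := by
  have h := hf.integrableOn_mul_rpow_mul_exp (ε := 1 / 4) (by norm_num)
  have := Integrable.mul_bdd (g := fun x : ℝ => Real.exp (-(1 / 4 * x)) * x ^ n)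
    (c := (n / (1 / 4) : ℝ) ^ (n : ℝ)) h (by fun_prop) (by
      filter_upwards [ae_restrict_mem measurableSet_Ioi] with x hx
      have hx0 : 0 < x := hx
      rw [Real.norm_of_nonneg (by positivity), Real.exp_neg, inv_mul_le_iff₀ (Real.exp_pos _),
        ← Real.rpow_natCast x n, mul_comm]
      exact rpow_le_mul_exp n.cast_nonneg (by norm_num) hx0.le)
  refine this.congr (ae_of_all _ fun x => ?_)
  simp only
  rw [show -(1 / 2 * x) = -(1 / 4 * x) + -(1 / 4 * x) by ring, Real.exp_add]
  ring

/-- The coefficient of `x ^ j` in `laguerre α k x`. -/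
noncomputable def laguerreMonomialCoeff (α : ℝ) (k j : ℕ) : ℝ :=
  (-1) ^ j * (Real.Gamma (k + α + 1) / (Real.Gamma (j + α + 1) * ((k - j)! : ℝ))) / (j ! : ℝ)

theorem laguerre_eq_sum (α : ℝ) (k : ℕ) (x : ℝ) :
    laguerre α k x = ∑ j ∈ Finset.range (k + 1), laguerreMonomialCoeff α k j * x ^ j := by
  unfold laguerre laguerreMonomialCoeff
  exact Finset.sum_congr rfl fun j _ => by ring

theorem Gamma_nat_add_pos {α : ℝ} (hα : -1 < α) (k : ℕ) : 0 < Real.Gamma (k + α + 1) :=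
  Real.Gamma_pos_of_pos (by have : (0 : ℝ) ≤ k := k.cast_nonneg; linarith)

theorem laguerreMonomialCoeff_self_ne_zero {α : ℝ} (hα : -1 < α) (k : ℕ) :
    laguerreMonomialCoeff α k k ≠ 0 := by
  have h := Gamma_nat_add_pos hα k
  unfold laguerreMonomialCoeff
  simp [h.ne', Nat.factorial_ne_zero]

theorem LaguerreAdmissible.laguerreCoeff_eq_sum {α : ℝ} {f : ℝ → ℝ}
    (hf : LaguerreAdmissible α f) (k : ℕ) :
    laguerreCoeff α f k = Real.sqrt ((k ! : ℝ) / Real.Gamma (k + α + 1)) *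
      ∑ j ∈ Finset.range (k + 1), laguerreMonomialCoeff α k j *
        ∫ x in Ioi 0, f x * x ^ α * Real.exp (-(1 / 2 * x)) * x ^ j := by
  simp only [← integral_const_mul]
  rw [← integral_finsetSum _ fun j _ => (hf.integrableOn_mul_rpow_mul_exp_mul_pow j).const_mul _,
    ← integral_const_mul]
  refine integral_congr_ae (ae_of_all _ fun x => ?_)
  simp only [laguerreFun, laguerre_eq_sum, Finset.mul_sum, Finset.sum_mul]
  refine Finset.sum_congr rfl fun j _ => ?_
  rw [show -(1 / 2 * x) = -x / 2 by ring]
  ring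

/-- The Laguerre coefficients of an admissible function determine it almost everywhere. -/
theorem LaguerreAdmissible.ae_eq_of_laguerreCoeff_eq {α : ℝ} (hα : -1 < α) {f g : ℝ → ℝ}
    (hf : LaguerreAdmissible α f) (hg : LaguerreAdmissible α g)
    (h : ∀ k, laguerreCoeff α f k = laguerreCoeff α g k) :
    f =ᵐ[volume.restrict (Ioi 0)] g := by
  have hmom : ∀ n : ℕ, ∫ x in Ioi 0, f x * x ^ α * Real.exp (-(1 / 2 * x)) * x ^ n =
      ∫ x in Ioi 0, g x * x ^ α * Real.exp (-(1 / 2 * x)) * x ^ n := by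
    intro n
    -- The system from coefficients to moments is triangular with nonzero diagonal.
    induction n using Nat.strong_induction_on with
    | _ n ih =>
      have hn := h n
      have hs : Real.sqrt ((n ! : ℝ) / Real.Gamma (n + α + 1)) ≠ 0 := by
        have := Gamma_nat_add_pos hα n
        positivity
      rw [hf.laguerreCoeff_eq_sum, hg.laguerreCoeff_eq_sum, mul_right_inj' hs,
        Finset.sum_range_succ, Finset.sum_range_succ,
        Finset.sum_congr rfl fun j hj => by rw [ih j (Finset.mem_range.1 hj)],
        add_right_inj, mul_right_inj' (laguerreMonomialCoeff_self_ne_zero hα n)] at hn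
      exact hn
  -- Half of `e^(-x/2)` goes into `D` to make it integrable; the other half is the weight of the
  -- moments.
  have hD := ae_eq_zero_of_moments (a := 1 / 4)
    (D := fun x => f x * x ^ α * Real.exp (-(1 / 4 * x)) - g x * x ^ α * Real.exp (-(1 / 4 * x)))
    (by norm_num) ((hf.integrableOn_mul_rpow_mul_exp (by norm_num)).sub
      (hg.integrableOn_mul_rpow_mul_exp (by norm_num))) fun n => by
    refine Eq.trans ?_ ((integral_sub (hf.integrableOn_mul_rpow_mul_exp_mul_pow n)
      (hg.integrableOn_mul_rpow_mul_exp_mul_pow n)).trans (sub_eq_zero.2 (hmom n)))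
    refine integral_congr_ae (ae_of_all _ fun x => ?_)
    simp only
    rw [show -(1 / 2 * x) = -(1 / 4 * x) + -(1 / 4 * x) by ring, Real.exp_add]
    ring
  filter_upwards [hD, ae_restrict_mem measurableSet_Ioi] with x hx hx0
  have hx0 : 0 < x := hx0
  simp only [Pi.zero_apply, ← sub_mul] at hx
  have h1 := (Real.rpow_pos_of_pos hx0 α).ne'
  have h2 := (Real.exp_pos (-(1 / 4 * x))).ne'
  simpa [h1, h2, sub_eq_zero] using hx

/-! ### The kernel: pointwise bound and continuity. -/

theorem one_sub_exp_neg_pos {t : ℝ} (ht : 0 < t) : 0 < 1 - Real.exp (-t) :=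
  sub_pos.2 (by simpa using ht)

theorem one_sub_exp_neg_le (t : ℝ) : 1 - Real.exp (-t) ≤ t := by
  linarith [Real.add_one_le_exp (-t)]

theorem div_one_add_le_one_sub_exp_neg {t : ℝ} (ht : 0 < t) :
    t / (1 + t) ≤ 1 - Real.exp (-t) := by
  have h1 := Real.add_one_le_exp t
  have h2 : Real.exp (-t) ≤ (1 + t)⁻¹ := by
    rw [Real.exp_neg]
    exact inv_anti₀ (by linarith) (by linarith)
  have h3 : t / (1 + t) = 1 - (1 + t)⁻¹ := by field_simp; ring
  linarith

/-- The integrand in the Laplace-type representation of the fractional integration kernel, from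
`(k + 1) ^ (-σ) = Γ(σ)⁻¹ ∫ t ^ (σ - 1) e ^ (-(k + 1) t)` and the generating function of the
Laguerre polynomials. -/
noncomputable def kernelIntegrand (α σ x t : ℝ) : ℝ :=
  t ^ (σ - 1) * Real.exp (-t) * (1 - Real.exp (-t)) ^ (-(α + 1)) *
    Real.exp (x / 2 - x / (1 - Real.exp (-t)))

/-- The fractional integration kernel. -/
noncomputable def fractionalKernel (α σ x : ℝ) : ℝ :=
  Real.Gamma (α + 1) / Real.Gamma σ * ∫ t in Ioi 0, kernelIntegrand α σ x t

theorem measurable_kernelIntegrand (α σ : ℝ) :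
    Measurable fun z : ℝ × ℝ => kernelIntegrand α σ z.1 z.2 := by
  unfold kernelIntegrand
  fun_prop

theorem kernelIntegrand_nonneg (α σ x : ℝ) {t : ℝ} (ht : 0 < t) :
    0 ≤ kernelIntegrand α σ x t := by
  have := one_sub_exp_neg_pos ht
  unfold kernelIntegrand
  positivity

/-- Put `q = 1 - e^(-t)`. From `q ≥ t/(1+t)`, the power of `q` costs `(1+t)^(α+1)`, which the factor
`e^(-t)` absorbs. In the exponent, one half of `x/q` cancels `x/2` because `q ≤ 1`; the other half
is at least `x/(2t)` because `q ≤ t`. -/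
theorem kernelIntegrand_le {α : ℝ} (hα : -1 < α) (σ : ℝ) {x t : ℝ} (hx : 0 ≤ x) (ht : 0 < t) :
    kernelIntegrand α σ x t ≤ (α + 1) ^ (α + 1) * Real.exp 1 *
      (t ^ (-(α + 1 - σ) - 1) * Real.exp (-(x / 2 / t))) := by
  have ha : 0 < α + 1 := by linarith
  have hq := one_sub_exp_neg_pos ht
  have hq1 : 1 - Real.exp (-t) ≤ 1 := by linarith [Real.exp_pos (-t)]
  have h1 : (1 - Real.exp (-t)) ^ (-(α + 1)) ≤
      (α + 1) ^ (α + 1) * Real.exp (1 + t) * t ^ (-(α + 1)) := by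
    calc (1 - Real.exp (-t)) ^ (-(α + 1)) ≤ (t / (1 + t)) ^ (-(α + 1)) :=
          Real.rpow_le_rpow_of_nonpos (by positivity) (div_one_add_le_one_sub_exp_neg ht)
            (by linarith)
      _ = (1 + t) ^ (α + 1) * t ^ (-(α + 1)) := by
          rw [Real.div_rpow ht.le (by linarith), Real.rpow_neg (by linarith : (0 : ℝ) ≤ 1 + t),
            div_inv_eq_mul, mul_comm]
      _ ≤ _ := by
          gcongr
          simpa using rpow_le_mul_exp ha.le one_pos (by linarith : (0 : ℝ) ≤ 1 + t)
  have h2 : x / 2 - x / (1 - Real.exp (-t)) ≤ -(x / 2 / t) := by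
    have h3 : x / 2 ≤ x / 2 / (1 - Real.exp (-t)) := le_div_self (by linarith) hq hq1
    have h4 : x / 2 / t ≤ x / 2 / (1 - Real.exp (-t)) := by
      gcongr
      exact one_sub_exp_neg_le t
    have h5 : x / (1 - Real.exp (-t)) = 2 * (x / 2 / (1 - Real.exp (-t))) := by ring
    linarith
  unfold kernelIntegrand
  calc _ ≤ t ^ (σ - 1) * Real.exp (-t) * ((α + 1) ^ (α + 1) * Real.exp (1 + t) *
          t ^ (-(α + 1))) * Real.exp (-(x / 2 / t)) := by gcongr
    _ = (α + 1) ^ (α + 1) * (Real.exp (-t) * Real.exp (1 + t)) *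
          ((t ^ (σ - 1) * t ^ (-(α + 1))) * Real.exp (-(x / 2 / t))) := by ring
    _ = _ := by
      rw [← Real.exp_add, ← Real.rpow_add ht, neg_add_cancel_comm_assoc,
        show σ - 1 + -(α + 1) = -(α + 1 - σ) - 1 by ring]

theorem integral_rpow_mul_exp_neg_div {b y : ℝ} (hb : 0 < b) (hy : 0 < y) :
    ∫ t in Ioi 0, t ^ (-b - 1) * Real.exp (-(y / t)) = y ^ (-b) * Real.Gamma b := by
  -- The substitution `u = 1/t` turns the integral into a Gamma integral.
  have h := integral_comp_rpow_Ioi (fun u : ℝ => u ^ (b - 1) * Real.exp (-(y * u)))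
    (p := -1) (by norm_num)
  rw [Real.integral_rpow_mul_exp_neg_mul_Ioi hb hy, one_div, Real.inv_rpow hy.le,
    ← Real.rpow_neg hy.le] at h
  rw [← h]
  refine setIntegral_congr_fun measurableSet_Ioi fun t ht => ?_
  have ht : 0 < t := ht
  simp only [smul_eq_mul, Real.rpow_neg_one, abs_neg, abs_one, one_mul, ← div_eq_mul_inv y t]
  rw [← mul_assoc, ← Real.rpow_neg_one t, ← Real.rpow_mul ht.le, ← Real.rpow_add ht]
  congr 2
  ring

theorem integrableOn_rpow_mul_exp_neg_div {b y : ℝ} (hb : 0 < b) (hy : 0 < y) :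
    IntegrableOn (fun t => t ^ (-b - 1) * Real.exp (-(y / t))) (Ioi 0) :=
  -- A nonintegrable function has integral `0` by convention, so a nonzero value proves
  -- integrability.
  .of_integral_ne_zero (by
    rw [integral_rpow_mul_exp_neg_div hb hy]
    have := Real.Gamma_pos_of_pos hb
    positivity)

theorem abs_fractionalKernel_le {α σ : ℝ} (hα : -1 < α) (hσ : 0 < σ) (hσα : σ < α + 1) {x : ℝ}
    (hx : 0 < x) :
    |fractionalKernel α σ x| ≤ Real.Gamma (α + 1) / Real.Gamma σ *
      ((α + 1) ^ (α + 1) * Real.exp 1 * ((1 / 2) ^ (σ - α - 1) * Real.Gamma (α + 1 - σ))) *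
        x ^ (σ - α - 1) := by
  have hG : 0 < Real.Gamma (α + 1) := Real.Gamma_pos_of_pos (by linarith)
  have hG' : 0 < Real.Gamma σ := Real.Gamma_pos_of_pos hσ
  have hb : 0 < α + 1 - σ := by linarith
  rw [fractionalKernel, abs_mul, abs_of_pos (div_pos hG hG'), mul_assoc]
  gcongr
  rw [abs_of_nonneg (setIntegral_nonneg measurableSet_Ioi
    fun t ht => kernelIntegrand_nonneg α σ x ht)]
  have hpos : ∀ᵐ t ∂(volume.restrict (Ioi (0 : ℝ))), 0 < t := ae_restrict_mem measurableSet_Ioi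
  calc ∫ t in Ioi 0, kernelIntegrand α σ x t
      ≤ ∫ t in Ioi 0, (α + 1) ^ (α + 1) * Real.exp 1 *
          (t ^ (-(α + 1 - σ) - 1) * Real.exp (-(x / 2 / t))) :=
        integral_mono_of_nonneg (hpos.mono fun t ht => kernelIntegrand_nonneg α σ x ht)
          ((integrableOn_rpow_mul_exp_neg_div hb (half_pos hx)).const_mul _)
          (hpos.mono fun t ht => kernelIntegrand_le hα σ hx.le ht)
    _ = _ := by
        rw [integral_const_mul, integral_rpow_mul_exp_neg_div hb (half_pos hx),
          show x / 2 = 1 / 2 * x by ring, Real.mul_rpow (by norm_num) hx.le,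
          show -(α + 1 - σ) = σ - α - 1 by ring]
        ring

theorem continuousOn_fractionalKernel {α σ : ℝ} (hα : -1 < α) (hσα : σ < α + 1) :
    ContinuousOn (fractionalKernel α σ) (Ioi 0) := by
  intro x₀ hx₀
  have hx₀ : 0 < x₀ := hx₀
  have hpos : ∀ᵐ t ∂(volume.restrict (Ioi (0 : ℝ))), 0 < t := ae_restrict_mem measurableSet_Ioi
  refine ContinuousAt.continuousWithinAt (ContinuousAt.mul continuousAt_const ?_)
  -- The rate `x₀/4` serves every `x > x₀/2`, where `x/2 ≥ x₀/4`.
  refine continuousAt_of_dominated (bound := fun t => (α + 1) ^ (α + 1) * Real.exp 1 *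
      (t ^ (-(α + 1 - σ) - 1) * Real.exp (-(x₀ / 4 / t)))) ?_ ?_ ?_ ?_
  · exact Filter.Eventually.of_forall fun x =>
      ((measurable_kernelIntegrand α σ).comp measurable_prodMk_left).aestronglyMeasurable
  · filter_upwards [lt_mem_nhds (half_lt_self hx₀)] with x hx
    filter_upwards [hpos] with t ht
    rw [Real.norm_of_nonneg (kernelIntegrand_nonneg α σ x ht)]
    have ha : 0 < α + 1 := by linarith
    refine (kernelIntegrand_le hα σ (by linarith) ht).trans ?_
    have hx' : x₀ / 4 ≤ x / 2 := by linarith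
    gcongr
  · exact (integrableOn_rpow_mul_exp_neg_div (by linarith) (by linarith)).const_mul _
  · refine ae_of_all _ fun t => Continuous.continuousAt ?_
    unfold kernelIntegrand
    fun_prop

/-! ### Admissibility of the kernel. -/

theorem kernelIntegrand_eq (α σ x t : ℝ) :
    kernelIntegrand α σ x t = t ^ (σ - 1) * Real.exp (-t) * (1 - Real.exp (-t)) ^ (-(α + 1)) *
      Real.exp (-((1 / (1 - Real.exp (-t)) - 1 / 2) * x)) := by
  unfold kernelIntegrand
  congr 2
  ring

/-- With `q = 1 - e^(-t)`, the decay rate in `x` is `1/q - 1/2 ≥ 1/(2q)`. The `x`-integral is then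
at most a multiple of `q^(α+1)`, which cancels the singular power of `q` and leaves the integrand of
`Γ(σ)`. This gives admissibility at the endpoint `p = 1`, `γ = α`, and justifies Fubini below. -/
theorem integrable_kernelIntegrand_mul_rpow {α σ : ℝ} (hα : -1 < α) (hσ : 0 < σ) :
    Integrable (fun z : ℝ × ℝ => kernelIntegrand α σ z.1 z.2 * z.1 ^ α)
      ((volume.restrict (Ioi 0)).prod (volume.restrict (Ioi 0))) := by
  have ha : 0 < α + 1 := by linarith
  have hG : 0 < Real.Gamma (α + 1) := Real.Gamma_pos_of_pos ha
  have hpos : ∀ᵐ t ∂(volume.restrict (Ioi (0 : ℝ))), 0 < t := ae_restrict_mem measurableSet_Ioi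
  have hmeas : Measurable fun z : ℝ × ℝ => kernelIntegrand α σ z.1 z.2 * z.1 ^ α :=
    (measurable_kernelIntegrand α σ).mul (by fun_prop)
  have hs : ∀ t : ℝ, 0 < t →
      1 / (2 * (1 - Real.exp (-t))) ≤ 1 / (1 - Real.exp (-t)) - 1 / 2 := by
    intro t ht
    have hq := one_sub_exp_neg_pos ht
    have h1 : 1 ≤ 1 / (1 - Real.exp (-t)) := by
      rw [le_div_iff₀ hq]
      linarith [Real.exp_pos (-t)]
    have h2 : 1 / (2 * (1 - Real.exp (-t))) = 1 / (1 - Real.exp (-t)) / 2 := by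
      field_simp
    linarith
  have hs0 : ∀ t : ℝ, 0 < t → 0 < 1 / (1 - Real.exp (-t)) - 1 / 2 := fun t ht => by
    have hq := one_sub_exp_neg_pos ht
    exact lt_of_lt_of_le (by positivity) (hs t ht)
  have hval : ∀ t : ℝ, 0 < t → ∫ x in Ioi 0, kernelIntegrand α σ x t * x ^ α =
      t ^ (σ - 1) * Real.exp (-t) * (1 - Real.exp (-t)) ^ (-(α + 1)) *
        ((1 / (1 / (1 - Real.exp (-t)) - 1 / 2)) ^ (α + 1) * Real.Gamma (α + 1)) := by
    intro t ht
    rw [← Real.integral_rpow_mul_exp_neg_mul_Ioi ha (hs0 t ht), ← integral_const_mul]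
    refine integral_congr_ae (ae_of_all _ fun x => ?_)
    simp only [kernelIntegrand_eq, add_sub_cancel_right]
    ring
  rw [integrable_prod_iff' hmeas.aestronglyMeasurable]
  refine ⟨hpos.mono fun t ht => ?_, ?_⟩
  · refine .of_integral_ne_zero ?_
    rw [hval t ht]
    have hq := one_sub_exp_neg_pos ht
    have := hs0 t ht
    positivity
  · refine Integrable.mono' (g := fun t => 2 ^ (α + 1) * Real.Gamma (α + 1) *
      (Real.exp (-t) * t ^ (σ - 1))) ((Real.GammaIntegral_convergent hσ).const_mul _) ?_ ?_
    · exact hmeas.norm.stronglyMeasurable.integral_prod_left'.aestronglyMeasurable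
    · filter_upwards [hpos] with t ht
      have hq := one_sub_exp_neg_pos ht
      have hn : ∫ x in Ioi 0, ‖kernelIntegrand α σ x t * x ^ α‖ =
          ∫ x in Ioi 0, kernelIntegrand α σ x t * x ^ α :=
        setIntegral_congr_fun measurableSet_Ioi fun x hx => Real.norm_of_nonneg
          (mul_nonneg (kernelIntegrand_nonneg α σ x ht) (Real.rpow_nonneg (le_of_lt hx) _))
      rw [hn, hval t ht, Real.norm_of_nonneg (by have := hs0 t ht; positivity)]
      have h1 : 1 / (1 / (1 - Real.exp (-t)) - 1 / 2) ≤ 2 * (1 - Real.exp (-t)) := by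
        rw [one_div_le (hs0 t ht) (by positivity)]
        exact hs t ht
      calc _ ≤ t ^ (σ - 1) * Real.exp (-t) * (1 - Real.exp (-t)) ^ (-(α + 1)) *
            ((2 * (1 - Real.exp (-t))) ^ (α + 1) * Real.Gamma (α + 1)) := by
              have := hs0 t ht
              gcongr
        _ = _ := by
            rw [Real.mul_rpow (by norm_num) hq.le, Real.rpow_neg hq.le]
            have := (Real.rpow_pos_of_pos hq (α + 1)).ne'
            field_simp

theorem laguerreAdmissible_fractionalKernel {α σ : ℝ} (hα : -1 < α) (hσ : 0 < σ) :
    LaguerreAdmissible α (fractionalKernel α σ) := by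
  refine ⟨1, α, le_rfl, hα, Or.inr ⟨rfl, rfl⟩, ?_, ?_⟩
  · exact ((measurable_kernelIntegrand α σ).stronglyMeasurable.integral_prod_right'.const_mul
      _).aestronglyMeasurable
  · refine ((integrable_kernelIntegrand_mul_rpow hα hσ).integral_prod_left.norm.const_mul
      |Real.Gamma (α + 1) / Real.Gamma σ|).congr ?_
    filter_upwards [ae_restrict_mem measurableSet_Ioi] with x hx
    have hx : 0 < x := hx
    simp only [integral_mul_const]
    rw [Real.rpow_one, fractionalKernel, abs_mul, norm_mul, Real.norm_eq_abs,
      Real.norm_of_nonneg (by positivity), mul_assoc]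

/-! ### Laguerre coefficients of the kernel. -/

theorem exists_abs_laguerreFun_le (α : ℝ) (k : ℕ) :
    ∃ M : ℝ, ∀ x : ℝ, 0 < x → |laguerreFun α k x| ≤ M := by
  refine ⟨Real.sqrt ((k ! : ℝ) / Real.Gamma (k + α + 1)) *
    ∑ j ∈ Finset.range (k + 1), |laguerreMonomialCoeff α k j| * (j / (1 / 2) : ℝ) ^ (j : ℝ),
    fun x hx => ?_⟩
  rw [laguerreFun, mul_assoc, abs_mul, abs_of_nonneg (Real.sqrt_nonneg _)]
  gcongr
  rw [laguerre_eq_sum, Finset.mul_sum]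
  refine (Finset.abs_sum_le_sum_abs _ _).trans (Finset.sum_le_sum fun j _ => ?_)
  rw [abs_mul, abs_mul, mul_left_comm]
  gcongr
  rw [Real.abs_exp, abs_of_pos (by positivity), show -x / 2 = -(1 / 2 * x) by ring, Real.exp_neg,
    inv_mul_le_iff₀ (Real.exp_pos _), ← Real.rpow_natCast x j, mul_comm]
  exact rpow_le_mul_exp j.cast_nonneg (by norm_num) hx.le

theorem continuous_laguerreFun (α : ℝ) (k : ℕ) : Continuous (laguerreFun α k) := by
  unfold laguerreFun laguerre
  fun_prop

/-- The Laplace transform of `x ^ α L_k^α(x)`. -/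
theorem integral_exp_mul_laguerre_mul_rpow {α : ℝ} (hα : -1 < α) (k : ℕ) {q : ℝ} (hq : 0 < q) :
    ∫ x in Ioi 0, Real.exp (-(1 / q * x)) * laguerre α k x * x ^ α =
      Real.Gamma (k + α + 1) / (k ! : ℝ) * q ^ (α + 1) * (1 - q) ^ k := by
  have hs : 0 < 1 / q := by positivity
  have hj : ∀ j : ℕ, 0 < (j : ℝ) + α + 1 := fun j => by
    have : (0 : ℝ) ≤ j := j.cast_nonneg
    linarith
  have hint : ∀ j : ℕ, ∫ x in Ioi 0, x ^ ((j : ℝ) + α + 1 - 1) * Real.exp (-(1 / q * x)) =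
      q ^ j * q ^ (α + 1) * Real.Gamma (j + α + 1) := fun j => by
    rw [Real.integral_rpow_mul_exp_neg_mul_Ioi (hj j) hs, one_div_one_div, add_assoc,
      Real.rpow_add hq, Real.rpow_natCast]
  have hi : ∀ j : ℕ, IntegrableOn
      (fun x : ℝ => x ^ ((j : ℝ) + α + 1 - 1) * Real.exp (-(1 / q * x))) (Ioi 0) := fun j =>
    .of_integral_ne_zero (by
      rw [hint]
      have := Gamma_nat_add_pos hα j
      positivity)
  have hsum : ∫ x in Ioi 0, Real.exp (-(1 / q * x)) * laguerre α k x * x ^ α =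
      ∑ j ∈ Finset.range (k + 1), laguerreMonomialCoeff α k j *
        (q ^ j * q ^ (α + 1) * Real.Gamma (j + α + 1)) := by
    simp only [← hint, ← integral_const_mul]
    rw [← integral_finsetSum _ fun j _ => (hi j).const_mul _]
    refine setIntegral_congr_fun measurableSet_Ioi fun x hx => ?_
    have hx : 0 < x := hx
    simp only [laguerre_eq_sum, Finset.mul_sum, Finset.sum_mul]
    refine Finset.sum_congr rfl fun j _ => ?_
    rw [add_sub_cancel_right, Real.rpow_add hx, Real.rpow_natCast]
    ring
  -- The factors `Γ(j+α+1)` cancel, so the sum is the binomial expansion of `(1-q)^k`, term by term.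
  rw [hsum, show 1 - q = -q + 1 by ring, add_pow, Finset.mul_sum]
  refine Finset.sum_congr rfl fun j hjk => ?_
  have hjk : j ≤ k := Nat.lt_succ_iff.1 (Finset.mem_range.1 hjk)
  have h1 := (Gamma_nat_add_pos hα j).ne'
  have h2 : ((k - j)! : ℝ) ≠ 0 := by exact_mod_cast Nat.factorial_ne_zero _
  have h3 : (j ! : ℝ) ≠ 0 := by exact_mod_cast Nat.factorial_ne_zero _
  have h4 : (k ! : ℝ) ≠ 0 := by exact_mod_cast Nat.factorial_ne_zero _
  rw [Nat.cast_choose ℝ hjk, neg_pow q, laguerreMonomialCoeff, one_pow]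
  field_simp

/-- The two factors `e^(x/2)` and `e^(-x/2)` cancel, leaving the Laplace transform at `1/q` with `q
= 1 - e^(-t)`, where `(1-q)^k = e^(-kt)`. -/
theorem integral_kernelIntegrand_mul_laguerreFun {α : ℝ} (hα : -1 < α) (σ : ℝ) (k : ℕ) {t : ℝ}
    (ht : 0 < t) :
    ∫ x in Ioi 0, kernelIntegrand α σ x t * (laguerreFun α k x * x ^ α) =
      Real.sqrt (Real.Gamma (k + α + 1) / (k ! : ℝ)) *
        (t ^ (σ - 1) * Real.exp (-(((k : ℝ) + 1) * t))) := by
  have hq := one_sub_exp_neg_pos ht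
  have hsqrt : Real.sqrt ((k ! : ℝ) / Real.Gamma (k + α + 1)) * (Real.Gamma (k + α + 1) / k !) =
      Real.sqrt (Real.Gamma (k + α + 1) / (k ! : ℝ)) := by
    rw [← inv_div, Real.sqrt_inv, inv_mul_eq_div, Real.div_sqrt]
  calc _ = t ^ (σ - 1) * Real.exp (-t) * (1 - Real.exp (-t)) ^ (-(α + 1)) *
        Real.sqrt ((k ! : ℝ) / Real.Gamma (k + α + 1)) *
        ∫ x in Ioi 0, Real.exp (-(1 / (1 - Real.exp (-t)) * x)) * laguerre α k x * x ^ α := by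
        rw [← integral_const_mul]
        refine integral_congr_ae (ae_of_all _ fun x => ?_)
        simp only [kernelIntegrand, laguerreFun]
        rw [show -(1 / (1 - Real.exp (-t)) * x) =
          (x / 2 - x / (1 - Real.exp (-t))) + -x / 2 by ring, Real.exp_add _ (-x / 2)]
        ring
    _ = _ := by
        rw [integral_exp_mul_laguerre_mul_rpow hα k hq, ← hsqrt, Real.rpow_neg hq.le,
          sub_sub_cancel, ← Real.exp_nat_mul, show -(((k : ℝ) + 1) * t) = -t + k * -t by ring,
          Real.exp_add]
        have := (Real.rpow_pos_of_pos hq (α + 1)).ne'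
        field_simp

theorem laguerreCoeff_fractionalKernel {α σ : ℝ} (hα : -1 < α) (hσ : 0 < σ) (k : ℕ) :
    laguerreCoeff α (fractionalKernel α σ) k = Real.Gamma (α + 1) * ((k : ℝ) + 1) ^ (-σ) *
      Real.sqrt (Real.Gamma (k + α + 1) / (k ! : ℝ)) := by
  have hk : (0 : ℝ) < k + 1 := by positivity
  have hGσ := (Real.Gamma_pos_of_pos hσ).ne'
  obtain ⟨M, hM⟩ := exists_abs_laguerreFun_le α k
  have hint : Integrable (Function.uncurry fun x t : ℝ =>
      kernelIntegrand α σ x t * (laguerreFun α k x * x ^ α))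
      ((volume.restrict (Ioi 0)).prod (volume.restrict (Ioi 0))) := by
    refine ((integrable_kernelIntegrand_mul_rpow hα hσ).mul_bdd
      (g := fun z : ℝ × ℝ => laguerreFun α k z.1) (c := M)
      ((continuous_laguerreFun α k).comp continuous_fst).aestronglyMeasurable ?_).congr
      (ae_of_all _ fun z => ?_)
    · exact Measure.quasiMeasurePreserving_fst.ae
        ((ae_restrict_mem measurableSet_Ioi).mono fun x hx => hM x hx)
    · simp only [Function.uncurry]
      ring
  calc laguerreCoeff α (fractionalKernel α σ) k
      = Real.Gamma (α + 1) / Real.Gamma σ *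
        ∫ x in Ioi 0, ∫ t in Ioi 0, kernelIntegrand α σ x t * (laguerreFun α k x * x ^ α) := by
        rw [laguerreCoeff, ← integral_const_mul]
        refine integral_congr_ae (ae_of_all _ fun x => ?_)
        simp only [integral_mul_const, fractionalKernel]
        ring
    _ = Real.Gamma (α + 1) / Real.Gamma σ *
        ∫ t in Ioi 0, ∫ x in Ioi 0, kernelIntegrand α σ x t * (laguerreFun α k x * x ^ α) := by
        rw [integral_integral_swap hint]
    _ = Real.Gamma (α + 1) / Real.Gamma σ *
        (Real.sqrt (Real.Gamma (k + α + 1) / (k ! : ℝ)) *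
          ((1 / ((k : ℝ) + 1)) ^ σ * Real.Gamma σ)) := by
        rw [← Real.integral_rpow_mul_exp_neg_mul_Ioi hσ hk,
          ← integral_const_mul (Real.sqrt _)]
        congr 1
        refine setIntegral_congr_fun measurableSet_Ioi fun t ht => ?_
        exact integral_kernelIntegrand_mul_laguerreFun hα σ k ht
    _ = _ := by
        rw [one_div, Real.inv_rpow hk.le, Real.rpow_neg hk.le]
        field_simp

theorem isFractionalKernel_fractionalKernel {α σ : ℝ} (hα : -1 < α) (hσ : 0 < σ) :
    IsFractionalKernel α σ (fractionalKernel α σ) :=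
  ⟨laguerreAdmissible_fractionalKernel hα hσ, laguerreCoeff_fractionalKernel hα hσ⟩

end LaguerreKernel

theorem lemma2p1 (α σ : ℝ) (hα : -1 < α) (hσ : 0 < σ) (hσα : σ < α + 1) :
    ∃ C : ℝ, 0 < C ∧ ∃ g : ℝ → ℝ,
      LaguerreKernel.IsFractionalKernel α σ g ∧
      (∀ h : ℝ → ℝ, LaguerreKernel.IsFractionalKernel α σ h →
        h =ᵐ[volume.restrict (Ioi 0)] g) ∧
      ContinuousOn g (Ioi 0) ∧
      ∀ x : ℝ, 0 < x → |g x| ≤ C * x ^ (σ - α - 1) := by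
  have hg := LaguerreKernel.isFractionalKernel_fractionalKernel hα hσ
  -- The constant is read off by unification from `abs_fractionalKernel_le`.
  refine ⟨_, ?_, LaguerreKernel.fractionalKernel α σ, hg, fun h hh => ?_,
    LaguerreKernel.continuousOn_fractionalKernel hα hσα,
    fun x hx => LaguerreKernel.abs_fractionalKernel_le hα hσ hσα hx⟩
  · have ha : 0 < α + 1 := by linarith
    have h1 := Real.Gamma_pos_of_pos ha
    have h2 := Real.Gamma_pos_of_pos hσ
    have h3 : 0 < Real.Gamma (α + 1 - σ) := Real.Gamma_pos_of_pos (by linarith)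
    positivity
  · exact LaguerreKernel.LaguerreAdmissible.ae_eq_of_laguerreCoeff_eq hα hh.1 hg.1
      fun k => (hh.2 k).trans (hg.2 k).symm
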